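/- Let $d\ge 1$ and $B\ge 1$ be integers. For $V\subseteq\mathbb{R}^d$, the D-optimal experimental design problem with budget $B$ asks to minimize $f\big(\sum_{v\in S}vv^{\top}\big)$ over all multisets $S$ of exactly $B$ vectors of $V$ (repetitions allowed), where $f(A)=\det(A)^{-1/d}$ for positive semidefinite $A\in\mathbb{R}^{d\times d}$, with $f(A)=+\infty$ if $A$ is singular. Let $\mathrm{OPT}_B(V)\in(0,+\infty]$ be the infimum, with $\mathrm{OPT}_B(\emptyset)=+\infty$. A core-set function is a map $c$ that assigns to every finite set $V\subset\mathbb{R}^d$ a subset $c(V)\subseteq V$; it has size at most $t$ if $|c(V)|\le t$ for all $V$. It is an $\alpha$-composable core-set (for this problem with budget $B$) if for every finite collection of finite sets $V_1,\dots,V_p\subset\mathbb{R}^d$, $$\mathrm{OPT}_B\big(c(V_1)\cup\dots\cup c(V_p)\big)\le\alpha\cdot\mathrm{OPT}_B\big(V_1\cup\dots\cup V_p\big).$$ \textbf{Proposition.} There are universal constants $C,\kappa>0$ such that for every integer $d\ge 2$, every real $\beta\ge 1$ and every integer $B\ge Cd$: if $c$ is an $\alpha$-composable core-set of size at most $d^{\beta}$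 for D-optimal experimental design in $\mathbb{R}^d$ with budget $B$, then $$\alpha\ \ge\ \kappa\cdot\frac{d}{\beta\log^2 d}.$$ -/

import Mathlib

open scoped ENNReal

/-- Optimal value of the experimental design problem with input vectors `V ⊆ ℝ^d`, objective `f`
and budget `B`: the infimum of `f (∑_{v ∈ S} v vᵀ)` over all multisets `S` of exactly `B` vectors
of `V`. Values are in `[0, ∞]`; the value is `∞` if there is no such multiset. -/
noncomputable def experimentalDesignOpt {d : ℕ} (f : Matrix (Fin d) (Fin d) ℝ → ℝ≥0∞) (B : ℕ)
    (V : Set (Fin d → ℝ)) : ℝ≥0∞ :=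
  ⨅ (S : Multiset (Fin d → ℝ)) (_ : S.card = B ∧ ∀ v ∈ S, v ∈ V),
    f (S.map fun v => Matrix.vecMulVec v v).sum

/-- The D-optimality objective `A ↦ det(A)^(-1/d)` on positive semidefinite `d × d` matrices, equal
to `∞` when `A` is singular (`d ≥ 1`; in `[0, ∞]`, a negative power of `0` is `∞`). -/
noncomputable def dOptimality (d : ℕ) (A : Matrix (Fin d) (Fin d) ℝ) : ℝ≥0∞ :=
  ENNReal.ofReal A.det ^ (-(1 : ℝ) / (d : ℝ))

/-- `c` is an `α`-composable core-set (function) for the experimental design problem with objective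
`f` and budget `B`: it maps each finite set of vectors to one of its subsets, and for every finite
collection of finite sets, passing to the core-sets increases the optimum of the union by at most
the factor `α`. -/
def IsComposableCoreset {d : ℕ} (f : Matrix (Fin d) (Fin d) ℝ → ℝ≥0∞) (B : ℕ) (α : ℝ)
    (c : Finset (Fin d → ℝ) → Finset (Fin d → ℝ)) : Prop :=
  (∀ V, c V ⊆ V) ∧
    ∀ (p : ℕ) (V : Fin p → Finset (Fin d → ℝ)),
      experimentalDesignOpt f B (⋃ i, (c (V i) : Set (Fin d → ℝ))) ≤
        ENNReal.ofReal α * experimentalDesignOpt f B (⋃ i, (V i : Set (Fin d → ℝ)))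

/-! Split `ℝ^d` as `ℝ^m × ℝ^N` with `m ≈ d / log d`. Take a family `A` of sign vectors in `ℝ^m`, of
size above `3 N d^β`, with pairwise inner products at most `t ≈ √(β m log d)`
(`exists_nearly_orthogonal_signs`). The hard inputs are the graphs over `A` of integer matrices `T`.

A core-set of such a graph drops most of `A`. Averaging over a large box of matrices
(`exists_forall_notMem_add_single`) yields one `T` and one `a ∈ A` such that `a` is dropped from the
graph of `T + e_i aᵀ` for every row `i` at once. The instance consists of these `N` graphs and a
basis of the graph of `T`.

The full union contains the points `(a, Ta + m e_i)`, since `a ⬝ a = m`, so heights `m` above the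
graph of `T` are available in all `N` directions. The core-sets retain only points with `b ≠ a`,
whose height `a ⬝ b` is at most `t`; after a shear flattening the graph of `T`, AM-GM bounds their
determinant. The `d`-th root of the gap is about `m² / t² ≈ d / (β log² d)`. -/

/-- The information matrix `∑ v vᵀ` of a multiset of vectors. -/
noncomputable def designMatrix {ι : Type*} (S : Multiset (ι → ℝ)) : Matrix ι ι ℝ :=
  (S.map fun v => Matrix.vecMulVec v v).sum

/-! ### Determinants of information matrices: upper bound by AM-GM, lower bound by repeated columns.
-/

section DesignMatrix

variable {ι κ : Type*}

@[simp] lemma designMatrix_zero : designMatrix (0 : Multiset (ι → ℝ)) = 0 := by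
  simp [designMatrix]

@[simp] lemma designMatrix_cons (v : ι → ℝ) (S : Multiset (ι → ℝ)) :
    designMatrix (v ::ₘ S) = Matrix.vecMulVec v v + designMatrix S := by
  simp [designMatrix]

lemma designMatrix_map_mulVec [Fintype ι] (L : Matrix κ ι ℝ) (S : Multiset (ι → ℝ)) :
    designMatrix (S.map L.mulVec) = L * designMatrix S * L.transpose := by
  induction S using Multiset.induction with
  | empty => simp
  | cons v S ih =>
    rw [Multiset.map_cons, designMatrix_cons, designMatrix_cons, ih, Matrix.mul_add,
      Matrix.add_mul, Matrix.mul_vecMulVec, Matrix.vecMulVec_mul, Matrix.vecMul_transpose]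

lemma designMatrix_map_comp (e : κ ≃ ι) (S : Multiset (ι → ℝ)) :
    designMatrix (S.map fun v => v ∘ e) = (designMatrix S).submatrix e e := by
  induction S using Multiset.induction with
  | empty => simp
  | cons v S ih =>
    rw [Multiset.map_cons, designMatrix_cons, designMatrix_cons, ih]
    ext i j
    simp [Matrix.vecMulVec_apply]

variable [Fintype ι]

lemma posSemidef_designMatrix (S : Multiset (ι → ℝ)) : (designMatrix S).PosSemidef := by
  induction S using Multiset.induction with
  | empty => simpa using Matrix.PosSemidef.zero
  | cons v S ih =>
    rw [designMatrix_cons]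
    exact Matrix.PosSemidef.add (by simpa using Matrix.posSemidef_vecMulVec_self_star v) ih

lemma trace_designMatrix_le {b : ℝ} (S : Multiset (ι → ℝ)) (h : ∀ v ∈ S, v ⬝ᵥ v ≤ b) :
    (designMatrix S).trace ≤ S.card * b := by
  induction S using Multiset.induction with
  | empty => simp
  | cons v S ih =>
    rw [designMatrix_cons, Matrix.trace_add, Matrix.trace_vecMulVec, Multiset.card_cons]
    have h1 := h v (Multiset.mem_cons_self v S)
    have h2 := ih fun w hw => h w (Multiset.mem_cons_of_mem hw)
    push_cast
    linarith

lemma prod_le_sum_div_card_pow [Nonempty ι] (z : ι → ℝ) (hz : ∀ i, 0 ≤ z i) :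
    ∏ i, z i ≤ ((∑ i, z i) / Fintype.card ι) ^ Fintype.card ι := by
  have hc : (0 : ℝ) < Fintype.card ι := by exact_mod_cast Fintype.card_pos
  have h := Real.geom_mean_le_arith_mean Finset.univ (fun _ => 1) z (fun _ _ => zero_le_one)
    (by simpa using hc) (fun i _ => hz i)
  simp only [Real.rpow_one, Finset.sum_const, Finset.card_univ, nsmul_eq_mul, mul_one,
    one_mul] at h
  have hp : 0 ≤ ∏ i, z i := Finset.prod_nonneg fun i _ => hz i
  calc ∏ i, z i = ((∏ i, z i) ^ ((Fintype.card ι : ℝ)⁻¹)) ^ Fintype.card ι := by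
        rw [Real.rpow_inv_natCast_pow hp Fintype.card_ne_zero]
    _ ≤ _ := pow_le_pow_left₀ (Real.rpow_nonneg hp _) h _

variable [DecidableEq ι]

/-- AM-GM on the eigenvalues. -/
lemma Matrix.PosSemidef.det_le_trace_div_card_pow [Nonempty ι] {A : Matrix ι ι ℝ}
    (hA : A.PosSemidef) : A.det ≤ (A.trace / Fintype.card ι) ^ Fintype.card ι := by
  rw [hA.isHermitian.det_eq_prod_eigenvalues, hA.isHermitian.trace_eq_sum_eigenvalues]
  exact prod_le_sum_div_card_pow _ hA.eigenvalues_nonneg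

/-- The trace bound is only sharp for well-rounded configurations; `L` serves to round the vectors
first, at the price of `L.det ^ 2`. -/
lemma det_designMatrix_mul_sq_le [Nonempty ι] {b : ℝ} (L : Matrix ι ι ℝ)
    (S : Multiset (ι → ℝ)) (h : ∀ v ∈ S, L.mulVec v ⬝ᵥ L.mulVec v ≤ b) :
    L.det ^ 2 * (designMatrix S).det ≤ (S.card * b / Fintype.card ι) ^ Fintype.card ι := by
  have h1 := (posSemidef_designMatrix (S.map L.mulVec)).det_le_trace_div_card_pow
  have h2 : (designMatrix (S.map L.mulVec)).trace ≤ S.card * b := by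
    simpa using trace_designMatrix_le (S.map L.mulVec) (b := b) (by simpa using h)
  have h3 := (posSemidef_designMatrix (S.map L.mulVec)).trace_nonneg
  rw [designMatrix_map_mulVec, Matrix.det_mul, Matrix.det_mul, Matrix.det_transpose] at h1
  rw [designMatrix_map_mulVec] at h2 h3
  calc L.det ^ 2 * (designMatrix S).det = L.det * (designMatrix S).det * L.det := by ring
    _ ≤ _ := h1
    _ ≤ _ := by gcongr

/-- The multiset in which column `j` of `P` is repeated `n j` times. -/
lemma exists_multiset_columns (P : Matrix ι ι ℝ) {B : ℕ} (hι : 0 < Fintype.card ι) :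
    ∃ S : Multiset (ι → ℝ), S.card = B ∧ (∀ v ∈ S, ∃ j, v = P.col j) ∧
      ((B / Fintype.card ι : ℕ) : ℝ) ^ Fintype.card ι * P.det ^ 2 ≤ (designMatrix S).det := by
  classical
  obtain ⟨j₀⟩ := Fintype.card_pos_iff.1 hι
  set k := B / Fintype.card ι with hk
  -- The budget is spread evenly, and the remainder goes to the single column `j₀`.
  set n : ι → ℕ := fun j => k + if j = j₀ then B % Fintype.card ι else 0 with hn
  have hsum : ∑ j, n j = B := by
    simp [hn, Finset.sum_add_distrib, hk, Nat.div_add_mod]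
  refine ⟨∑ j, Multiset.replicate (n j) (P.col j), by simp [hsum], ?_, ?_⟩
  · intro v hv
    obtain ⟨j, -, hj⟩ := Multiset.mem_sum.1 hv
    exact ⟨j, Multiset.eq_of_mem_replicate hj⟩
  · have hD : designMatrix (∑ j, Multiset.replicate (n j) (P.col j)) =
        P * Matrix.diagonal (fun j => (n j : ℝ)) * P.transpose := by
      have : designMatrix (∑ j, Multiset.replicate (n j) (P.col j)) =
          ∑ j, (n j) • Matrix.vecMulVec (P.col j) (P.col j) := by
        simp only [designMatrix]
        rw [← Multiset.coe_mapAddMonoidHom, map_sum, Multiset.sum_sum]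
        simp
      rw [this]
      ext a b
      rw [Matrix.mul_apply, Matrix.sum_apply]
      simp only [Matrix.smul_apply, Matrix.vecMulVec_apply, Matrix.mul_diagonal,
        Matrix.transpose_apply, Matrix.col_apply]
      simp only [nsmul_eq_mul]
      exact Finset.sum_congr rfl fun j _ => by ring
    rw [hD, Matrix.det_mul, Matrix.det_mul, Matrix.det_transpose, Matrix.det_diagonal]
    have hp : (k : ℝ) ^ Fintype.card ι ≤ ∏ j, (n j : ℝ) := by
      rw [← Finset.card_univ, ← Finset.prod_const]
      exact Finset.prod_le_prod (fun _ _ => by positivity) fun j _ => by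
        simp only [hn, Nat.cast_add, le_add_iff_nonneg_right]
        exact Nat.cast_nonneg _
    nlinarith [mul_le_mul_of_nonneg_right hp (sq_nonneg P.det)]

end DesignMatrix

/-! ### From determinant gaps to approximation factors. -/

section Objective

/-- A gap between the determinants reachable in two sets, in terms of optimal values. -/
lemma inv_le_of_experimentalDesignOpt_le {d B : ℕ} (hd : 0 < d) {α ρ y : ℝ} (hρ : 0 < ρ)
    (hy : 0 < y) {V W : Set (Fin d → ℝ)}
    (h : experimentalDesignOpt (dOptimality d) B W ≤
      ENNReal.ofReal α * experimentalDesignOpt (dOptimality d) B V)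
    (hW : ∀ S : Multiset (Fin d → ℝ), S.card = B → (∀ v ∈ S, v ∈ W) →
      (designMatrix S).det ≤ ρ ^ d * y)
    (hV : ∃ S : Multiset (Fin d → ℝ), S.card = B ∧ (∀ v ∈ S, v ∈ V) ∧
      y ≤ (designMatrix S).det) : ρ⁻¹ ≤ α := by
  have hd' : (d : ℝ) ≠ 0 := by positivity
  obtain ⟨S, hS, hSV, hyS⟩ := hV
  have h1 : experimentalDesignOpt (dOptimality d) B V ≤
      ENNReal.ofReal (y ^ (-(1 : ℝ) / d)) := by
    refine (iInf₂_le S ⟨hS, hSV⟩).trans ?_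
    rw [← ENNReal.ofReal_rpow_of_pos hy, neg_div, ENNReal.rpow_neg, dOptimality, neg_div,
      ENNReal.rpow_neg, ENNReal.inv_le_inv]
    exact ENNReal.rpow_le_rpow (ENNReal.ofReal_le_ofReal hyS) (by positivity)
  have h2 : ENNReal.ofReal ((ρ ^ d * y) ^ (-(1 : ℝ) / d)) ≤
      experimentalDesignOpt (dOptimality d) B W := by
    refine le_iInf₂ fun S hS => ?_
    rw [← ENNReal.ofReal_rpow_of_pos (by positivity), neg_div, ENNReal.rpow_neg, dOptimality,
      neg_div, ENNReal.rpow_neg, ENNReal.inv_le_inv]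
    exact ENNReal.rpow_le_rpow (ENNReal.ofReal_le_ofReal (hW S hS.1 hS.2)) (by positivity)
  have hyp : 0 < y ^ (-(1 : ℝ) / d) := Real.rpow_pos_of_pos hy _
  have hpow : (ρ ^ d * y) ^ (-(1 : ℝ) / d) = ρ⁻¹ * y ^ (-(1 : ℝ) / d) := by
    rw [Real.mul_rpow (by positivity) hy.le, ← Real.rpow_natCast, ← Real.rpow_mul hρ.le,
      mul_div_cancel₀ _ hd', Real.rpow_neg_one]
  have h3 := h2.trans (h.trans (mul_le_mul_right h1 _))
  rw [hpow, ← ENNReal.ofReal_mul' hyp.le] at h3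
  by_contra! hα
  have hlt : α * y ^ (-(1 : ℝ) / d) < ρ⁻¹ * y ^ (-(1 : ℝ) / d) := by gcongr
  exact absurd h3 (not_le.2 ((ENNReal.ofReal_lt_ofReal_iff (by positivity)).2 hlt))

end Objective

/-! ### Nearly orthogonal sign vectors, by concentration and a greedy choice. -/

section SignVectors

variable {m : ℕ}

/-- The vertices of the cube `{1, -1}^m`. -/
def signCube (m : ℕ) : Finset (Fin m → ℤ) := Fintype.piFinset fun _ => {1, -1}

lemma mem_signCube {x : Fin m → ℤ} : x ∈ signCube m ↔ ∀ j, x j = 1 ∨ x j = -1 := by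
  simp [signCube]

lemma card_signCube : (signCube m).card = 2 ^ m := by
  simp [signCube]

lemma dotProduct_self_of_mem_signCube {x : Fin m → ℤ} (hx : x ∈ signCube m) :
    x ⬝ᵥ x = m := by
  have : ∀ j, x j * x j = 1 := fun j => by
    rcases mem_signCube.1 hx j with h | h <;> simp [h]
  simp [dotProduct, this]

/-- The sum factors over coordinates, each contributing `2 cosh s ≤ 2 exp (s² / 2)`. -/
lemma sum_exp_dotProduct_signCube_le {a : Fin m → ℤ} (ha : a ∈ signCube m) (s : ℝ) :
    ∑ x ∈ signCube m, Real.exp (s * ((a ⬝ᵥ x : ℤ) : ℝ)) ≤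
      2 ^ m * Real.exp (m * (s ^ 2 / 2)) := by
  have h1 : ∀ x ∈ signCube m, Real.exp (s * ((a ⬝ᵥ x : ℤ) : ℝ)) =
      ∏ j, Real.exp (s * (a j * x j)) := fun x _ => by
    rw [← Real.exp_sum, ← Finset.mul_sum]
    simp [dotProduct]
  have h2 : ∀ j, ∑ y ∈ ({1, -1} : Finset ℤ), Real.exp (s * (a j * y)) = 2 * Real.cosh s := by
    intro j
    rw [Real.cosh_eq, Finset.sum_pair (by decide)]
    rcases mem_signCube.1 ha j with h | h <;> simp [h] <;> ring
  rw [Finset.sum_congr rfl h1, signCube,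
    Finset.sum_prod_piFinset ({1, -1} : Finset ℤ) fun j y => Real.exp (s * (a j * y))]
  simp only [h2, Finset.prod_const, Finset.card_univ, Fintype.card_fin]
  rw [mul_pow, Real.exp_nat_mul]
  have := Real.cosh_le_exp_half_sq s
  have h0 := (Real.cosh_pos s).le
  gcongr

lemma card_filter_lt_abs_dotProduct_le {a : Fin m → ℤ} (ha : a ∈ signCube m) (hm : 0 < m)
    {t : ℝ} (ht : 0 ≤ t) :
    (((signCube m).filter fun x => t < |((a ⬝ᵥ x : ℤ) : ℝ)|).card : ℝ) ≤
      2 ^ m * (2 * Real.exp (-(t ^ 2 / (2 * m)))) := by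
  have hm' : (0 : ℝ) < m := by exact_mod_cast hm
  -- The Chernoff exponent `m s² / 2 - s t` is minimal at this `s`.
  set s : ℝ := t / m with hs
  have hs0 : 0 ≤ s := by positivity
  set F := (signCube m).filter fun x => t < |((a ⬝ᵥ x : ℤ) : ℝ)|
  have h1 : (F.card : ℝ) * Real.exp (s * t) ≤
      ∑ x ∈ signCube m, (Real.exp (s * ((a ⬝ᵥ x : ℤ) : ℝ)) +
        Real.exp (-s * ((a ⬝ᵥ x : ℤ) : ℝ))) := by
    rw [← nsmul_eq_mul, ← Finset.sum_const]
    refine (Finset.sum_le_sum fun x hx => ?_).trans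
      (Finset.sum_le_sum_of_subset_of_nonneg (Finset.filter_subset _ _)
        fun _ _ _ => by positivity)
    have hx := (Finset.mem_filter.1 hx).2
    rcases le_total 0 ((a ⬝ᵥ x : ℤ) : ℝ) with h | h
    · rw [abs_of_nonneg h] at hx
      have : Real.exp (s * t) ≤ Real.exp (s * ((a ⬝ᵥ x : ℤ) : ℝ)) := by gcongr
      linarith [Real.exp_pos (-s * ((a ⬝ᵥ x : ℤ) : ℝ))]
    · rw [abs_of_nonpos h] at hx
      have : Real.exp (s * t) ≤ Real.exp (-s * ((a ⬝ᵥ x : ℤ) : ℝ)) := by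
        rw [neg_mul_comm]; gcongr
      linarith [Real.exp_pos (s * ((a ⬝ᵥ x : ℤ) : ℝ))]
  rw [Finset.sum_add_distrib] at h1
  have h2 := sum_exp_dotProduct_signCube_le ha s
  have h3 := sum_exp_dotProduct_signCube_le ha (-s)
  rw [neg_sq] at h3
  have h4 : Real.exp (m * (s ^ 2 / 2)) =
      Real.exp (-(t ^ 2 / (2 * m))) * Real.exp (s * t) := by
    rw [← Real.exp_add]
    congr 1
    rw [hs]
    field_simp
    ring
  rw [h4] at h2 h3
  refine le_of_mul_le_mul_right ?_ (Real.exp_pos (s * t))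
  linarith

/-- Many nearly orthogonal sign vectors. -/
lemma exists_nearly_orthogonal_signs (hm : 0 < m) {t : ℝ} (ht : 0 ≤ t) (htm : t < m)
    (n : ℕ)
    (hn : n * (2 * Real.exp (-(t ^ 2 / (2 * m)))) < 1) :
    ∃ A ⊆ signCube m, n ≤ A.card ∧
      ∀ a ∈ A, ∀ b ∈ A, a ≠ b → |((a ⬝ᵥ b : ℤ) : ℝ)| ≤ t := by
  have he := Real.exp_pos (-(t ^ 2 / (2 * m)))
  induction n with
  | zero => exact ⟨∅, by simp, by simp, by simp⟩
  | succ n ih =>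
    push_cast at hn
    obtain ⟨A, hAQ, hAn, hA⟩ := ih (by linarith)
    by_cases hlt : n + 1 ≤ A.card
    · exact ⟨A, hAQ, hlt, hA⟩
    have hcard : A.card = n := by omega
    obtain ⟨x, hxQ, hx⟩ : ∃ x ∈ signCube m, ∀ a ∈ A, x ≠ a ∧ |((a ⬝ᵥ x : ℤ) : ℝ)| ≤ t := by
      by_contra! hcon
      -- Union bound: if no vector extends `A`, the exceptional sets of its `n` members cover the
      -- cube, contradicting `hn`.
      have hsub : signCube m ⊆ A.biUnion fun a =>
          (signCube m).filter fun x => t < |((a ⬝ᵥ x : ℤ) : ℝ)| := by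
        intro x hx
        obtain ⟨a, ha, hax⟩ := hcon x hx
        refine Finset.mem_biUnion.2 ⟨a, ha, Finset.mem_filter.2 ⟨hx, ?_⟩⟩
        -- A member of `A` lies in its own exceptional set because `t < m`.
        by_cases hxa : x = a
        · subst hxa
          rw [dotProduct_self_of_mem_signCube hx]
          simpa using htm
        · exact hax hxa
      have h1 : ((2 : ℝ) ^ m) ≤ A.card • (2 ^ m * (2 * Real.exp (-(t ^ 2 / (2 * m))))) := by
        calc ((2 : ℝ) ^ m) = ((signCube m).card : ℝ) := by simp [card_signCube]
          _ ≤ ∑ a ∈ A, (((signCube m).filter fun x => t < |((a ⬝ᵥ x : ℤ) : ℝ)|).card : ℝ) := by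
            exact_mod_cast (Finset.card_le_card hsub).trans Finset.card_biUnion_le
          _ ≤ _ := Finset.sum_le_card_nsmul _ _ _ fun a ha =>
            card_filter_lt_abs_dotProduct_le (hAQ ha) hm ht
      rw [hcard, nsmul_eq_mul] at h1
      have h2 : (0 : ℝ) < 2 ^ m := by positivity
      nlinarith
    refine ⟨insert x A, Finset.insert_subset hxQ hAQ, ?_, ?_⟩
    · rw [Finset.card_insert_of_notMem fun h => (hx x h).1 rfl, hcard]
    · intro a ha b hb hab
      rw [Finset.mem_insert] at ha hb
      rcases ha with hax | ha <;> rcases hb with hbx | hb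
      · exact absurd (hax.trans hbx.symm) hab
      · rw [hax, dotProduct_comm]; exact (hx b hb).2
      · rw [hbx]; exact (hx a ha).2
      · exact hA a ha b hb hab

end SignVectors

/-! ### Double counting over a box of integer matrices. -/

/-- If each integer matrix `T` keeps at most `k` of the vectors of `A`, then some vector is kept by
none of the rank-one translates that add it to one of the rows of a suitable `T`. -/
lemma exists_forall_notMem_add_single {m N k : ℕ} (A : Finset (Fin m → ℤ))
    (hA : ∀ a ∈ A, ∀ j, -1 ≤ a j ∧ a j ≤ 1)
    (K : (Fin N → Fin m → ℤ) → Finset (Fin m → ℤ)) (hK : ∀ T, (K T).card ≤ k)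
    (h : 3 * N * k < A.card) :
    ∃ T, ∃ a ∈ A, ∀ i, a ∉ K (T + (Pi.single i a : Fin N → Fin m → ℤ)) := by
  classical
  by_contra! hcon
  have hN : Nonempty (Fin N) := by
    obtain ⟨a, ha⟩ := Finset.card_pos.1 (Nat.zero_lt_of_lt h)
    exact ⟨(hcon 0 a ha).choose⟩
  choose! f hf using hcon
  set D := N * m with hD
  -- Translates leave the box by at most one unit on each side. With `D` entries and this side
  -- length, the enlarged box is at most `(1 + 2 / L) ^ D ≤ exp (2 D / L) < 3` times as large.
  set L := 2 * D + 1 with hL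
  let box (u v : ℤ) : Finset (Fin N → Fin m → ℤ) :=
    Fintype.piFinset fun _ => Fintype.piFinset fun _ => Finset.Icc u v
  have hbox : ∀ u v, (box u v).card = (v + 1 - u).toNat ^ D := fun u v => by
    simp [box, hD, ← pow_mul, mul_comm]
  have hmem : ∀ u v T, T ∈ box u v ↔ ∀ i j, u ≤ T i j ∧ T i j ≤ v := fun u v T => by
    simp [box]
  have h1 : (box 1 L ×ˢ A).card ≤
      ((Finset.univ : Finset (Fin N)) ×ˢ ((box 0 (L + 1)).sigma K)).card := by
    -- The row index, the translate and `a` together determine `T`.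
    refine Finset.card_le_card_of_injOn
      (fun p => (f p.1 p.2, ⟨p.1 + (Pi.single (f p.1 p.2) p.2 : Fin N → Fin m → ℤ), p.2⟩)) ?_ ?_
    · rintro ⟨T, a⟩ hTa
      obtain ⟨hT, ha⟩ := Finset.mem_product.1 hTa
      refine Finset.mem_product.2 ⟨Finset.mem_univ _, Finset.mem_sigma.2 ⟨?_, hf T a ha⟩⟩
      rw [hmem] at hT ⊢
      intro i j
      have h1 : 1 ≤ T i j ∧ T i j ≤ L := hT i j
      have h2 := hA a ha j
      by_cases hi : i = f T a
      · subst hi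
        simp only [Pi.add_apply, Pi.single_eq_same]
        constructor <;> linarith
      · simp only [Pi.add_apply, Pi.single_eq_of_ne hi, Pi.zero_apply]
        constructor <;> linarith
    · rintro ⟨T, a⟩ - ⟨T', a'⟩ - heq
      simp only [Prod.mk.injEq, Sigma.mk.injEq, heq_eq_eq] at heq
      obtain ⟨h1, h2, rfl⟩ := heq
      rw [h1] at h2
      rw [add_right_cancel h2]
  rw [Finset.card_product, Finset.card_product, Finset.card_sigma, hbox, Finset.card_univ,
    Fintype.card_fin] at h1
  have h2 : ∑ T ∈ box 0 (L + 1), (K T).card ≤ (L + 2) ^ D * k := by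
    refine (Finset.sum_le_card_nsmul _ _ k fun T _ => hK T).trans ?_
    rw [hbox, smul_eq_mul]
    have : ((L : ℤ) + 1 + 1 - 0).toNat = L + 2 := by omega
    rw [this]
  have h3 : ((L : ℤ) + 1 - 1).toNat = L := by omega
  rw [h3] at h1
  have h4 : (L + 2) ^ D ≤ 3 * L ^ D := by
    have hL0 : (0 : ℝ) < L := by positivity
    have : ((L : ℝ) + 2) ^ D ≤ 3 * (L : ℝ) ^ D := by
      calc ((L : ℝ) + 2) ^ D = (2 / L + 1) ^ D * (L : ℝ) ^ D := by
            rw [← mul_pow]; congr 1; field_simp; ring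
        _ ≤ Real.exp (2 / L) ^ D * (L : ℝ) ^ D := by
            gcongr; exact Real.add_one_le_exp _
        _ ≤ 3 * (L : ℝ) ^ D := by
            gcongr
            rw [← Real.exp_nat_mul]
            refine (Real.exp_le_exp.2 ?_).trans Real.exp_one_lt_three.le
            rw [← mul_div_assoc, div_le_one hL0, hL]
            push_cast
            linarith
    exact_mod_cast this
  have h5 : L ^ D * A.card ≤ L ^ D * (3 * N * k) := by
    calc L ^ D * A.card ≤ N * ((L + 2) ^ D * k) := h1.trans (Nat.mul_le_mul_left _ h2)
      _ ≤ N * (3 * L ^ D * k) := by gcongr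
      _ = _ := by ring
  exact absurd (Nat.le_of_mul_le_mul_left h5 (by positivity)) (not_le.2 h)

lemma det_designMatrix_map_comp {ι κ : Type*} [Fintype ι] [Fintype κ] [DecidableEq ι]
    [DecidableEq κ] (e : κ ≃ ι) (S : Multiset (ι → ℝ)) :
    (designMatrix (S.map fun v => v ∘ e)).det = (designMatrix S).det := by
  rw [designMatrix_map_comp, Matrix.det_submatrix_equiv_self]

/-- Rounding `B / d` down to an integer multiplicity costs at most a factor 2. -/
lemma one_le_div_and_le_two_mul_div_mul {d B : ℕ} (hd : 0 < d) (hBd : d ≤ B) :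
    1 ≤ B / d ∧ (B : ℝ) ≤ 2 * (B / d : ℕ) * d := by
  have hn1 : 1 ≤ B / d := (Nat.one_le_div_iff hd).2 hBd
  have h1 := Nat.div_add_mod B d
  have h2 := Nat.mod_lt B hd
  have h3 : B ≤ 2 * (B / d) * d := by nlinarith
  exact ⟨hn1, by exact_mod_cast h3⟩

/-! ### The hard instance: graphs of integer matrices. -/

section GraphPoint

variable {m N d : ℕ} (e : Fin m ⊕ Fin N ≃ Fin d)

/-- The point `(x, T x)` of the graph of an integer matrix `T`, in `ℝ^d ≃ ℝ^m × ℝ^N`. -/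
def graphPoint (T : Fin N → Fin m → ℤ) (x : Fin m → ℤ) : Fin d → ℝ :=
  fun l => Sum.elim (fun j => (x j : ℝ)) (fun i => ((T i ⬝ᵥ x : ℤ) : ℝ)) (e.symm l)

lemma graphPoint_comp (T : Fin N → Fin m → ℤ) (x : Fin m → ℤ) :
    graphPoint e T x ∘ e =
      Sum.elim (fun j => (x j : ℝ)) (fun i => ((T i ⬝ᵥ x : ℤ) : ℝ)) := by
  funext l
  simp [graphPoint]

lemma graphPoint_injective (T : Fin N → Fin m → ℤ) : Function.Injective (graphPoint e T) := by
  intro x y h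
  funext j
  have := congrFun h (e (Sum.inl j))
  simpa [graphPoint] using this

/-- The shear that flattens the graph of `T`, followed by a scaling of the two factors. -/
noncomputable def flattening (r s : ℝ) (T : Fin N → Fin m → ℤ) :
    Matrix (Fin m ⊕ Fin N) (Fin m ⊕ Fin N) ℝ :=
  Matrix.fromBlocks (r • (1 : Matrix (Fin m) (Fin m) ℝ)) 0
    (-(s • Matrix.of fun i j => (T i j : ℝ))) (s • (1 : Matrix (Fin N) (Fin N) ℝ))

lemma det_flattening (r s : ℝ) (T : Fin N → Fin m → ℤ) :
    (flattening r s T).det = r ^ m * s ^ N := by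
  simp [flattening, Matrix.det_fromBlocks_zero₁₂]

lemma flattening_mulVec_graphPoint (r s : ℝ) (T T' : Fin N → Fin m → ℤ) (x : Fin m → ℤ) :
    (flattening r s T).mulVec (graphPoint e T' x ∘ e) =
      Sum.elim (fun j => r * x j) (fun i => s * (((T' i - T i) ⬝ᵥ x : ℤ) : ℝ)) := by
  rw [graphPoint_comp, flattening, Matrix.fromBlocks_mulVec]
  congr 1
  · funext j
    simp [Matrix.smul_mulVec]
  · funext i
    simp only [Sum.elim_comp_inl, Sum.elim_comp_inr, Matrix.neg_mulVec, Matrix.smul_mulVec,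
      Matrix.one_mulVec, Pi.add_apply, Pi.neg_apply, Pi.smul_apply, smul_eq_mul, sub_dotProduct]
    simp only [Matrix.mulVec, dotProduct, Matrix.of_apply]
    push_cast
    ring

lemma sum_elim_dotProduct_self (u : Fin m → ℝ) (w : Fin N → ℝ) :
    (Sum.elim u w) ⬝ᵥ (Sum.elim u w) = u ⬝ᵥ u + w ⬝ᵥ w := by
  simp [dotProduct, Fintype.sum_sum_type]

/-- The determinants reachable with vectors close to the graph of `T`. -/
lemma det_designMatrix_le_of_near_graph {t : ℝ} (hm : 0 < m) (ht : 0 < t)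
    (T : Fin N → Fin m → ℤ) (S : Multiset (Fin d → ℝ))
    (hS : ∀ v ∈ S, ∃ T' x, v = graphPoint e T' x ∧ (x ⬝ᵥ x : ℤ) ≤ m ∧
      ∑ i, (((T' i - T i) ⬝ᵥ x : ℤ) : ℝ) ^ 2 ≤ t ^ 2) :
    (designMatrix S).det ≤ (S.card * 2 / d) ^ d * (m ^ m * (t ^ 2) ^ N) := by
  have hm' : (0 : ℝ) < m := by exact_mod_cast hm
  have : Nonempty (Fin m ⊕ Fin N) := ⟨Sum.inl ⟨0, hm⟩⟩
  have hd : Fintype.card (Fin m ⊕ Fin N) = d := by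
    rw [Fintype.card_congr e, Fintype.card_fin]
  -- The scalings make the base part and the height part each of squared norm at most 1, hence `b =
  -- 2`.
  have h := det_designMatrix_mul_sq_le (b := 2) (flattening (√m)⁻¹ t⁻¹ T)
    (S.map fun v => v ∘ e) (by
      intro v hv
      obtain ⟨w, hw, rfl⟩ := Multiset.mem_map.1 hv
      obtain ⟨T', x, rfl, hx, hT'⟩ := hS w hw
      rw [flattening_mulVec_graphPoint, sum_elim_dotProduct_self]
      have h1 : (fun j => (√(m : ℝ))⁻¹ * (x j : ℝ)) ⬝ᵥ (fun j => (√(m : ℝ))⁻¹ * (x j : ℝ)) =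
          (m : ℝ)⁻¹ * ((x ⬝ᵥ x : ℤ) : ℝ) := by
        simp only [dotProduct]
        push_cast
        rw [Finset.mul_sum]
        refine Finset.sum_congr rfl fun j _ => ?_
        rw [mul_mul_mul_comm, ← mul_inv, Real.mul_self_sqrt hm'.le]
      have h2 : (fun i => t⁻¹ * (((T' i - T i) ⬝ᵥ x : ℤ) : ℝ)) ⬝ᵥ
          (fun i => t⁻¹ * (((T' i - T i) ⬝ᵥ x : ℤ) : ℝ)) =
          (t ^ 2)⁻¹ * ∑ i, (((T' i - T i) ⬝ᵥ x : ℤ) : ℝ) ^ 2 := by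
        rw [dotProduct, Finset.mul_sum]
        exact Finset.sum_congr rfl fun i _ => by ring
      rw [h1, h2]
      have h3 : (m : ℝ)⁻¹ * ((x ⬝ᵥ x : ℤ) : ℝ) ≤ 1 := by
        rw [inv_mul_le_one₀ hm']
        exact_mod_cast hx
      have h4 : (t ^ 2)⁻¹ * ∑ i, (((T' i - T i) ⬝ᵥ x : ℤ) : ℝ) ^ 2 ≤ 1 := by
        rw [inv_mul_le_one₀ (by positivity)]
        exact hT'
      linarith)
  rw [det_designMatrix_map_comp, det_flattening, hd, Multiset.card_map] at h
  have h5 : (((√(m : ℝ))⁻¹) ^ m * (t⁻¹) ^ N) ^ 2 = ((m : ℝ) ^ m * (t ^ 2) ^ N)⁻¹ := by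
    rw [mul_pow, ← pow_mul, mul_comm m 2, pow_mul, inv_pow, Real.sq_sqrt hm'.le, ← pow_mul,
      mul_comm N 2, pow_mul, inv_pow, mul_inv, inv_pow, inv_pow]
  rw [h5, inv_mul_le_iff₀ (by positivity)] at h
  linarith

/-- The determinant reachable with a basis of the graph of `T` and, for each row `i`, a vector of
the graph lifted along the coordinate `i`. -/
lemma exists_multiset_lifted_graph (B : ℕ) (hd : 0 < d) (T : Fin N → Fin m → ℤ)
    {a : Fin m → ℤ} (ha : a ∈ signCube m) :
    ∃ S : Multiset (Fin d → ℝ), S.card = B ∧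
      (∀ v ∈ S, (∃ j, v = graphPoint e T (Pi.single j 1)) ∨
        ∃ i, v = graphPoint e (T + (Pi.single i a : Fin N → Fin m → ℤ)) a) ∧
      ((B / d : ℕ) : ℝ) ^ d * ((m : ℝ) ^ N) ^ 2 ≤ (designMatrix S).det := by
  have hdc : Fintype.card (Fin m ⊕ Fin N) = d := by
    rw [Fintype.card_congr e, Fintype.card_fin]
  set TR : Matrix (Fin N) (Fin m) ℝ := Matrix.of fun i j => (T i j : ℝ) with hTR
  set X : Matrix (Fin m) (Fin N) ℝ := Matrix.of fun j _ => (a j : ℝ) with hX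
  -- The columns are the points `(e_j, T e_j)` and `(a, Ta + m e_i)`; the Schur complement of the
  -- identity block is `m • 1`.
  set P := Matrix.fromBlocks (1 : Matrix (Fin m) (Fin m) ℝ) X TR
    (TR * X + (m : ℝ) • (1 : Matrix (Fin N) (Fin N) ℝ)) with hP
  have hdet : P.det = (m : ℝ) ^ N := by
    rw [hP, Matrix.det_fromBlocks_one₁₁]
    simp
  obtain ⟨S, hS, hSP, hSdet⟩ := exists_multiset_columns P (B := B) (by rw [hdc]; exact hd)
  refine ⟨S.map fun v => v ∘ e.symm, by simpa using hS, ?_, ?_⟩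
  · intro v hv
    obtain ⟨w, hw, rfl⟩ := Multiset.mem_map.1 hv
    obtain ⟨l, rfl⟩ := hSP w hw
    rcases l with j | i
    · refine Or.inl ⟨j, ?_⟩
      funext l
      simp only [graphPoint, Function.comp_apply]
      rcases e.symm l with j' | i'
      · simp [hP, Matrix.one_apply, Pi.single_apply]
      · simp [hP, hTR]
    · refine Or.inr ⟨i, ?_⟩
      funext l
      simp only [graphPoint, Function.comp_apply]
      rcases e.symm l with j' | i'
      · simp [hP, hX]
      · by_cases hi : i' = i
        · subst hi
          simp only [Sum.elim_inr, Pi.add_apply, Pi.single_eq_same, add_dotProduct,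
            dotProduct_self_of_mem_signCube ha]
          simp [hP, hX, hTR, Matrix.mul_apply, dotProduct]
        · simp [hP, hX, hTR, Matrix.mul_apply, hi, dotProduct]
  · rw [det_designMatrix_map_comp, ← hdet]
    rwa [hdc] at hSdet

variable {B k : ℕ} {α : ℝ} {c : Finset (Fin d → ℝ) → Finset (Fin d → ℝ)}

/-- Lower bound for composable core-sets from a family of nearly orthogonal sign vectors. -/
lemma IsComposableCoreset.inv_le_of_signs (hc : IsComposableCoreset (dOptimality d) B α c)
    (e : Fin m ⊕ Fin N ≃ Fin d) (hm : 0 < m) (hBd : d ≤ B) (hk : ∀ V, (c V).card ≤ k)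
    {A : Finset (Fin m → ℤ)} (hA : A ⊆ signCube m) (hcard : 3 * N * k < A.card) {t : ℝ}
    (ht : 0 < t) (horth : ∀ a ∈ A, ∀ b ∈ A, a ≠ b → |((a ⬝ᵥ b : ℤ) : ℝ)| ≤ t) {ρ : ℝ}
    (hρ : 0 < ρ) (hρt : 4 ^ d * (m ^ m * (t ^ 2) ^ N) ≤ ρ ^ d * ((m : ℝ) ^ N) ^ 2) :
    ρ⁻¹ ≤ α := by
  classical
  have hm' : (0 : ℝ) < m := by exact_mod_cast hm
  have hd : 0 < d := by
    have := Fintype.card_congr e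
    simp at this
    omega
  have hd' : (0 : ℝ) < d := by exact_mod_cast hd
  let V (T : Fin N → Fin m → ℤ) : Finset (Fin d → ℝ) := A.image (graphPoint e T)
  obtain ⟨T, a, haA, ha⟩ := exists_forall_notMem_add_single (N := N) (k := k) A
    (fun a ha j => by rcases mem_signCube.1 (hA ha) j with h | h <;> omega)
    -- The core-set of the graph, pulled back to `A`.
    (fun T => A.filter fun b => graphPoint e T b ∈ c (V T))
    (fun T => (Finset.card_le_card_of_injOn (graphPoint e T)
      (fun b hb => (Finset.mem_filter.1 hb).2)
      ((graphPoint_injective e T).injOn)).trans (hk _)) hcard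
  let T' (i : Fin N) : Fin N → Fin m → ℤ := T + (Pi.single i a : Fin N → Fin m → ℤ)
  let V₀ : Finset (Fin d → ℝ) := Finset.univ.image fun j => graphPoint e T (Pi.single j 1)
  let W : Fin (N + 1) → Finset (Fin d → ℝ) := Fin.cons V₀ fun i => V (T' i)
  set n := B / d with hn
  obtain ⟨hn1, hBn⟩ := one_le_div_and_le_two_mul_div_mul hd hBd
  rw [← hn] at hn1 hBn
  refine inv_le_of_experimentalDesignOpt_le hd hρ
    (y := (n : ℝ) ^ d * ((m : ℝ) ^ N) ^ 2) (by positivity) (hc.2 (N + 1) W) ?_ ?_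
  · intro S hS hSW
    have h1 := det_designMatrix_le_of_near_graph e hm ht T S (fun v hv => by
      obtain ⟨l, hl⟩ := Set.mem_iUnion.1 (hSW v hv)
      have hl' := hc.1 _ hl
      refine Fin.cases (motive := fun l => v ∈ c (W l) → v ∈ W l → _) ?_ ?_ l hl hl'
      · intro _ hv
        obtain ⟨j, -, rfl⟩ := Finset.mem_image.1 hv
        refine ⟨T, Pi.single j 1, rfl, ?_, ?_⟩
        · simpa using Nat.one_le_iff_ne_zero.2 hm.ne'
        · simp; positivity
      · intro i hvc hv
        obtain ⟨b, hb, rfl⟩ := Finset.mem_image.1 hv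
        refine ⟨T' i, b, rfl, (dotProduct_self_of_mem_signCube (hA hb)).le, ?_⟩
        have hab : a ≠ b := by
          rintro rfl
          exact ha i (Finset.mem_filter.2 ⟨hb, hvc⟩)
        -- Only row `i` was changed, so the height over the graph of `T` is `a ⬝ b` in direction
        -- `i`.
        have hsum : ∑ i', (((T' i i' - T i') ⬝ᵥ b : ℤ) : ℝ) ^ 2 = ((a ⬝ᵥ b : ℤ) : ℝ) ^ 2 := by
          rw [Finset.sum_eq_single i]
          · simp [T']
          · intro i' _ hi'
            simp [T', hi']
          · simp
        rw [hsum]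
        exact sq_le_sq' (abs_le.1 (horth a haA b hb hab)).1 (abs_le.1 (horth a haA b hb hab)).2)
    rw [hS] at h1
    have h2 : (B : ℝ) * 2 / d ≤ 4 * n := by
      rw [div_le_iff₀ hd']
      linarith
    calc (designMatrix S).det ≤ (B * 2 / d) ^ d * (m ^ m * (t ^ 2) ^ N) := h1
      _ ≤ (4 * n) ^ d * (m ^ m * (t ^ 2) ^ N) := by gcongr
      _ = (n : ℝ) ^ d * (4 ^ d * (m ^ m * (t ^ 2) ^ N)) := by ring
      _ ≤ (n : ℝ) ^ d * (ρ ^ d * ((m : ℝ) ^ N) ^ 2) := by gcongr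
      _ = _ := by ring
  · obtain ⟨S, hS, hSW, hdet⟩ := exists_multiset_lifted_graph e B hd T (hA haA)
    refine ⟨S, hS, fun v hv => Set.mem_iUnion.2 ?_, hdet⟩
    rcases hSW v hv with ⟨j, rfl⟩ | ⟨i, rfl⟩
    · exact ⟨0, Finset.mem_coe.2 (Finset.mem_image_of_mem _ (Finset.mem_univ j))⟩
    · exact ⟨i.succ, Finset.mem_coe.2 (Finset.mem_image_of_mem _ haA)⟩

end GraphPoint

/-! ### The small-dimension bound, numerical estimates and choice of parameters. -/

/-- The trivial lower bound, from the standard basis. -/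
lemma IsComposableCoreset.half_le {d B : ℕ} {α : ℝ}
    {c : Finset (Fin d → ℝ) → Finset (Fin d → ℝ)}
    (hc : IsComposableCoreset (dOptimality d) B α c) (hd : 0 < d) (hBd : d ≤ B) :
    1 / 2 ≤ α := by
  classical
  have : Nonempty (Fin d) := ⟨⟨0, hd⟩⟩
  have hd' : (0 : ℝ) < d := by exact_mod_cast hd
  let V : Finset (Fin d → ℝ) := Finset.univ.image fun j => Pi.single j 1
  set n := B / d with hn
  obtain ⟨hn1, hBn⟩ := one_le_div_and_le_two_mul_div_mul hd hBd
  rw [← hn] at hn1 hBn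
  rw [one_div]
  refine inv_le_of_experimentalDesignOpt_le hd two_pos (y := (n : ℝ) ^ d) (by positivity)
    (hc.2 1 fun _ => V) ?_ ?_
  · intro S hS hSV
    have h1 := det_designMatrix_mul_sq_le (b := 1) (1 : Matrix (Fin d) (Fin d) ℝ) S (by
      intro v hv
      obtain ⟨_, hl⟩ := Set.mem_iUnion.1 (hSV v hv)
      obtain ⟨j, -, rfl⟩ := Finset.mem_image.1 (hc.1 _ hl)
      rw [Matrix.one_mulVec]
      simp)
    rw [Matrix.det_one, one_pow, one_mul, hS, mul_one, Fintype.card_fin] at h1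
    rw [← mul_pow]
    refine h1.trans (pow_le_pow_left₀ (by positivity) ?_ d)
    rwa [div_le_iff₀ hd']
  · obtain ⟨S, hS, hSP, hdet⟩ := exists_multiset_columns (1 : Matrix (Fin d) (Fin d) ℝ) (B := B)
      (by simpa using hd)
    refine ⟨S, hS, fun v hv => Set.mem_iUnion.2 ⟨0, ?_⟩, by simpa using hdet⟩
    obtain ⟨j, rfl⟩ := hSP v hv
    refine Finset.mem_coe.2 (Finset.mem_image.2 ⟨j, Finset.mem_univ j, ?_⟩)
    funext l
    simp [Matrix.one_apply, Pi.single_apply]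

/-- The left side has only `q ^ N`. Supplying `q ^ m` costs at most `m ^ m`, as `q m ≥ 1`; with the
`m ^ m` already present this is at most `exp (2 d)`, because `m log m ≤ m log d ≤ d`. -/
lemma four_pow_mul_le_pow_mul {m N d : ℕ} (hm : 0 < m) (hd : m + N = d)
    (hml : m * Real.log d ≤ d) {q : ℝ} (hq : 0 < q) (hqm : 1 ≤ q * m) :
    4 ^ d * ((m : ℝ) ^ m * (q * (m : ℝ) ^ 2) ^ N) ≤
      (4 * (Real.exp 2 * q)) ^ d * ((m : ℝ) ^ N) ^ 2 := by
  have hm' : (0 : ℝ) < m := by exact_mod_cast hm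
  have hmd : (m : ℝ) ≤ d := by exact_mod_cast (by omega : m ≤ d)
  have hmm : (m : ℝ) ^ m ≤ Real.exp d := by
    have h1 : Real.log m ≤ Real.log d := Real.log_le_log hm' hmd
    calc (m : ℝ) ^ m = Real.exp (m * Real.log m) := by
          rw [Real.exp_nat_mul, Real.exp_log hm']
      _ ≤ Real.exp d := by
          gcongr
          nlinarith
  have hmq : (m : ℝ) ^ m ≤ Real.exp 2 ^ d * q ^ m := by
    have h1 : Real.exp 2 ^ d = Real.exp d * Real.exp d := by
      rw [← Real.exp_nat_mul, ← Real.exp_add]; congr 1; ring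
    have h2 : 1 ≤ q ^ m * (m : ℝ) ^ m := by
      rw [← mul_pow]; exact one_le_pow₀ hqm
    calc (m : ℝ) ^ m ≤ (m : ℝ) ^ m * (q ^ m * (m : ℝ) ^ m) :=
          le_mul_of_one_le_right (by positivity) h2
      _ = (m : ℝ) ^ m * (m : ℝ) ^ m * q ^ m := by ring
      _ ≤ Real.exp d * Real.exp d * q ^ m := by gcongr
      _ = _ := by rw [h1]
  have hqd : q ^ d = q ^ m * q ^ N := by rw [← pow_add, hd]
  rw [mul_pow 4, mul_pow (Real.exp 2), hqd, mul_pow q]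
  calc 4 ^ d * ((m : ℝ) ^ m * (q ^ N * ((m : ℝ) ^ 2) ^ N))
      ≤ 4 ^ d * (Real.exp 2 ^ d * q ^ m * (q ^ N * ((m : ℝ) ^ 2) ^ N)) := by gcongr
    _ = _ := by ring

lemma div_le_inv_of_exp_two {d m β l : ℝ} (hβ : 0 < β) (hl : 0 < l) (hd : 0 < d) (hm : 0 < m)
    (h : d ≤ 2 * (m * l)) :
    1 / 400 * (d / (β * l ^ 2)) ≤ (4 * (Real.exp 2 * (6 * (β * l) / m)))⁻¹ := by
  rw [le_inv_comm₀ (by positivity) (by positivity)]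
  have hexp : Real.exp 2 ≤ 7.5 := by
    have h1 : Real.exp 2 = Real.exp 1 * Real.exp 1 := by rw [← Real.exp_add]; norm_num
    rw [h1]
    nlinarith [Real.exp_one_lt_d9, Real.exp_pos 1]
  have hinv : (1 / 400 * (d / (β * l ^ 2)))⁻¹ = 400 * (β * l ^ 2) / d := by
    field_simp
  rw [hinv]
  calc 4 * (Real.exp 2 * (6 * (β * l) / m)) ≤ 4 * (7.5 * (6 * (β * l) / m)) := by gcongr
    _ = 180 * (β * l) / m := by ring
    _ ≤ _ := by
      rw [div_le_div_iff₀ hm hd]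
      have h1 : 180 * (β * l) * d ≤ 180 * (β * l) * (2 * (m * l)) := by gcongr
      have h0 : 0 ≤ β * l * (m * l) := by positivity
      nlinarith

theorem mainTheorem12 :
    ∃ C κ : ℝ, 0 < C ∧ 0 < κ ∧
      ∀ (d : ℕ), 2 ≤ d → ∀ (β : ℝ), 1 ≤ β → ∀ (B : ℕ), C * (d : ℝ) ≤ (B : ℝ) →
        ∀ (c : Finset (Fin d → ℝ) → Finset (Fin d → ℝ)),
          (∀ V, ((c V).card : ℝ) ≤ (d : ℝ) ^ β) →
            ∀ (α : ℝ), IsComposableCoreset (dOptimality d) B α c →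
              κ * ((d : ℝ) / (β * Real.log (d : ℝ) ^ 2)) ≤ α := by
  refine ⟨1, 1 / 400, one_pos, by norm_num, fun d hd2 β hβ B hB c hcard α hc => ?_⟩
  have hBd : d ≤ B := by rw [one_mul] at hB; exact_mod_cast hB
  have hd2' : (2 : ℝ) ≤ d := by exact_mod_cast hd2
  have hd0 : (0 : ℝ) < d := by linarith
  set l := Real.log d with hl
  have hl2 : 0.69 < l := by
    have := Real.log_le_log two_pos hd2'
    linarith [Real.log_two_gt_d9]
  have hl0 : 0 < l := by linarith
  have hden : 0 < β * l ^ 2 := by positivity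
  -- In this range the claimed bound is at most `200 / 400 = 1 / 2`, which
  -- `IsComposableCoreset.half_le` supplies.
  by_cases hbig : (d : ℝ) ≤ 200 * (β * l ^ 2)
  · have h1 : (d : ℝ) / (β * l ^ 2) ≤ 200 := by rwa [div_le_iff₀ hden]
    linarith [hc.half_le (by omega) hBd]
  push Not at hbig
  have hl2sq : 0.47 < l ^ 2 := by nlinarith
  have hd9 : (9 : ℝ) ≤ d := by nlinarith
  have hl1 : 1 ≤ l := by
    rw [hl, Real.le_log_iff_exp_le hd0]
    linarith [Real.exp_one_lt_three]
  have hβl : 1 ≤ β * l := by nlinarith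
  -- Up to rounding, the largest `m` for which `m ^ m` stays below `exp d`, so that its `d`-th root
  -- is bounded.
  set m := ⌊(d : ℝ) / l⌋₊ with hm
  have hmle : (m : ℝ) * l ≤ d := by
    rw [← le_div_iff₀ hl0]
    exact Nat.floor_le (by positivity)
  have hmge : (d : ℝ) ≤ 2 * (m * l) := by
    have h1 : (d : ℝ) / l < m + 1 := Nat.lt_floor_add_one _
    rw [div_lt_iff₀ hl0] at h1
    nlinarith
  have hmd' : (m : ℝ) ≤ d := by nlinarith [(Nat.cast_nonneg m : (0 : ℝ) ≤ m)]
  have hmd : m ≤ d := by exact_mod_cast hmd'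
  have hmbig : 100 * (β * l) < m := by
    refine lt_of_mul_lt_mul_right ?_ hl0.le
    nlinarith
  have hm0' : (0 : ℝ) < m := by linarith
  have hm0 : 0 < m := by exact_mod_cast hm0'
  set N := d - m with hN
  have hdmN : m + N = d := by omega
  let e : Fin m ⊕ Fin N ≃ Fin d := finSumFinEquiv.trans (finCongr hdmN)
  -- The 6 makes the tail `exp (-t² / (2 m))` equal to `D ^ (-3)`, beating the roughly `6 D²` needed
  -- for `3 N k + 1` vectors.
  set t := √(6 * (β * l) * m) with ht
  have ht2 : t ^ 2 = 6 * (β * l) * m := Real.sq_sqrt (by positivity)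
  have ht0 : 0 < t := Real.sqrt_pos.2 (by positivity)
  have htm : t < m := by
    rw [ht, Real.sqrt_lt' hm0']
    nlinarith
  set D := (d : ℝ) ^ β with hD
  have hDexp : D = Real.exp (β * l) := by
    rw [hD, Real.rpow_def_of_pos hd0, mul_comm]
  have hdD : (d : ℝ) ≤ D := by
    simpa using Real.rpow_le_rpow_of_exponent_le (by linarith : (1 : ℝ) ≤ d) hβ
  set k := ⌊D⌋₊ with hk
  have hkD : (k : ℝ) ≤ D := Nat.floor_le (by linarith)
  have hNd : (N : ℝ) ≤ d := by exact_mod_cast Nat.sub_le d m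
  obtain ⟨A, hAQ, hAcard, horth⟩ := exists_nearly_orthogonal_signs hm0 ht0.le htm
    (3 * N * k + 1) (by
      have h1 : t ^ 2 / (2 * m) = 3 * (β * l) := by
        rw [ht2]; field_simp; ring
      have h2 : Real.exp (-(3 * (β * l))) = (D ^ 3)⁻¹ := by
        rw [Real.exp_neg, hDexp, ← Real.exp_nat_mul]
        norm_num
      have h3 : (N : ℝ) * k ≤ D * D := by
        have : (N : ℝ) ≤ D := hNd.trans hdD
        gcongr
      rw [h1, h2, ← mul_assoc, ← div_eq_mul_inv, div_lt_one (by positivity)]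
      push_cast
      nlinarith)
  set ρ := 4 * (Real.exp 2 * (6 * (β * l) / m)) with hρ
  have hρ0 : 0 < ρ := by positivity
  have hmain : 4 ^ d * ((m : ℝ) ^ m * (t ^ 2) ^ N) ≤ ρ ^ d * ((m : ℝ) ^ N) ^ 2 := by
    have htq : t ^ 2 = 6 * (β * l) / m * (m : ℝ) ^ 2 := by
      rw [ht2]; field_simp
    rw [htq]
    refine four_pow_mul_le_pow_mul hm0 hdmN hmle (by positivity) ?_
    rw [div_mul_cancel₀ _ hm0'.ne']
    linarith
  have hfin := hc.inv_le_of_signs e hm0 hBd (fun V => Nat.le_floor (hcard V)) hAQ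
    (Nat.lt_of_succ_le hAcard) ht0 horth hρ0 hmain
  refine le_trans ?_ hfin
  exact div_le_inv_of_exp_two (by linarith) hl0 hd0 hm0' hmge
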